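/- Let $0<q<1$. Write $(a;q)_\infty=\prod_{n\ge 0}(1-aq^n)$, $(a;q)_\lambda=(a;q)_\infty/(aq^\lambda;q)_\infty$ for $\lambda\in\mathbb C$, and $$\Gamma_q(z)=\frac{(q;q)_\infty}{(q^z;q)_\infty}(1-q)^{1-z},\qquad z\in\mathbb C,$$ where $1/\Gamma_q$ is understood as an entire function, equal to $0$ at the poles of $\Gamma_q$. Let $\omega:\mathbb R\to\mathbb C$ be bounded and continuous with $\omega(x\pm1)=-\omega(x)$ for all $x\in\mathbb R$, and let $\alpha,\beta,\gamma,\delta\in\mathbb C$ satisfy $\alpha+\delta=\beta+\gamma$ and $\operatorname{Re}(\alpha+\beta+\gamma+\delta)>2$. Then both integrals below converge absolutely, and $$\int_{-\infty}^{\infty}\frac{q^{(\alpha-\beta)x+x^2}\,\omega(x)\,dx}{\Gamma_q(\alpha+x)\Gamma_q(\beta-x)\Gamma_q(\gamma+x)\Gamma_q(\delta-x)} =\frac{(-q;q)_{\alpha+\delta-2}}{(1+q)^{\alpha+\delta-2}}\, \frac{\Gamma_{q^2}\!\left(\tfrac12\right)^2}{\Gamma_{q^2}\!\left(\tfrac{\alpha+\beta}{2}\right)\Gamma_{q^2}\!\left(\tfrac{\gamma+\delta}{2}\right)\Gamma_q(\alpha+\delta-1)}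 \int_0^1\frac{q^{(\alpha-\beta)x+x^2}\,\omega(x)\,dx}{\Gamma_{q^2}\!\left(\tfrac{\alpha-\beta+1}{2}+x\right)\Gamma_{q^2}\!\left(\tfrac{\beta-\alpha+1}{2}-x\right)}.$$ -/

import Mathlib

open MeasureTheory

noncomputable section

/-- The infinite `q`-shifted factorial `(a; q)_∞ = ∏_{n ≥ 0} (1 - a q ^ n)`. -/
def qPochInf (a : ℂ) (q : ℝ) : ℂ :=
  ∏' n : ℕ, (1 - a * (q : ℂ) ^ n)

/-- The `q`-shifted factorial `(a; q)_s = (a; q)_∞ / (a q ^ s; q)_∞` with complex index `s`. -/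
def qPoch (a : ℂ) (q : ℝ) (s : ℂ) : ℂ :=
  qPochInf a q / qPochInf (a * (q : ℂ) ^ s) q

/-- The `q`-gamma function `Γ_q(z) = (q; q)_∞ / (q ^ z; q)_∞ * (1 - q) ^ (1 - z)`.
At the poles, which are the zeros of `(q ^ z; q)_∞`, the value here is `0`, and therefore
`1 / qGamma q z` is `0` there: this is the value of the entire function `1 / Γ_q`. -/
def qGamma (q : ℝ) (z : ℂ) : ℂ :=
  qPochInf (q : ℂ) q / qPochInf ((q : ℂ) ^ z) q * ((1 - q : ℝ) : ℂ) ^ (1 - z)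

end

open Filter Topology

/-! Cut the line into unit intervals. Under $x\mapsto x+n$ the quadratic exponent contributes
$q^{n^2}$ and an $n$-th power, antiperiodicity contributes $(-1)^n$, and the reciprocal $q$-gamma
functions become products $(\cdot\,;q)_\infty$. The sum over translates is thus a bilateral series
$S(a,b,d)$ with $a=q^{\alpha-\beta+2x}$, $b=q^{\beta-x}$, $d=q^{\delta-x}$; the balance condition
$\alpha+\delta=\beta+\gamma$ turns $ad$ into $q^{\gamma+x}$ (`gammaKernel_add_intCast`). Its terms
decay like $|abd/q|^{|n|}$, and $abd/q=q^{\alpha+\delta-1}$ is free of $x$, so the condition on real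
parts is what justifies unfolding (`integral_gammaKernel`).

The series has a closed form (`tsum_bilateralTerm`). A telescoping relation links $S(a,b,d)$ to
$S(a,bq,d)$; iterating it sends $b$, then by symmetry $d$, to $0$ and produces infinite products.
What remains is the theta series $S(a,0,0)$, summed by Jacobi's triple product, itself the limit of
a terminating version obtained by telescoping.

In the closed form only the theta factor $(aq,q/a;q^2)_\infty$ depends on $x$, and it is a constant
times the two reciprocal $\Gamma_{q^2}$ on the right (`inv_qGamma_sq_mul_inv_qGamma_sq`). The rest
is bookkeeping of constants (`gammaKernelFactor_mul_tsum`). -/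

/-! ### Analytic properties of the infinite q-shifted factorial -/

lemma summable_norm_neg_mul_pow {q : ℝ} (hq0 : 0 < q) (hq1 : q < 1) (a : ℂ) :
    Summable fun n : ℕ => ‖-(a * (q : ℂ) ^ n)‖ := by
  simp only [norm_neg, norm_mul, norm_pow, Complex.norm_real, Real.norm_of_nonneg hq0.le]
  exact (summable_geometric_of_lt_one hq0.le hq1).mul_left _

lemma multipliable_qPochInf {q : ℝ} (hq0 : 0 < q) (hq1 : q < 1) (a : ℂ) :
    Multipliable fun n : ℕ => 1 - a * (q : ℂ) ^ n := by
  simpa only [sub_eq_add_neg] using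
    multipliable_one_add_of_summable (summable_norm_neg_mul_pow hq0 hq1 a)

lemma qPochInf_eq_one_sub_mul {q : ℝ} (hq0 : 0 < q) (hq1 : q < 1) (a : ℂ) :
    qPochInf a q = (1 - a) * qPochInf (a * q) q := by
  have h : (fun n : ℕ => 1 - a * (q : ℂ) ^ (n + 1)) = fun n : ℕ => 1 - a * q * (q : ℂ) ^ n := by
    ext n; rw [pow_succ]; ring
  have hm : Multipliable fun n : ℕ => 1 - a * (q : ℂ) ^ (n + 1) := by
    rw [h]; exact multipliable_qPochInf hq0 hq1 _
  have h2 := tprod_eq_zero_mul' (f := fun n : ℕ => 1 - a * (q : ℂ) ^ n) hm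
  simp only [h, pow_zero, mul_one] at h2
  exact h2

@[simp]
lemma qPochInf_zero (q : ℝ) : qPochInf 0 q = 1 := by
  simp [qPochInf]

lemma qPochInf_ne_zero {q : ℝ} (hq0 : 0 < q) (hq1 : q < 1) {a : ℂ} (ha : ‖a‖ < 1) :
    qPochInf a q ≠ 0 := by
  have := tprod_one_add_ne_zero_of_summable (f := fun n : ℕ => -(a * (q : ℂ) ^ n)) (fun n h => ?_)
    (summable_norm_neg_mul_pow hq0 hq1 a)
  · simpa only [sub_eq_add_neg, qPochInf] using this
  · have h1 : a * (q : ℂ) ^ n = 1 := by linear_combination -h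
    have h2 : ‖a * (q : ℂ) ^ n‖ < 1 := by
      rw [norm_mul, norm_pow, Complex.norm_real, Real.norm_of_nonneg hq0.le]
      exact mul_lt_one_of_nonneg_of_lt_one_left (norm_nonneg _) ha (pow_le_one₀ hq0.le hq1.le)
    rw [h1] at h2
    simp at h2

lemma norm_qPochInf_le {q : ℝ} (hq0 : 0 < q) (hq1 : q < 1) (a : ℂ) :
    ‖qPochInf a q‖ ≤ Real.exp (‖a‖ / (1 - q)) := by
  refine le_of_tendsto (multipliable_qPochInf hq0 hq1 a).hasProd.norm
    (Eventually.of_forall fun s => ?_)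
  beta_reduce
  calc ∏ i ∈ s, ‖1 - a * (q : ℂ) ^ i‖ ≤ ∏ i ∈ s, (1 + ‖a‖ * q ^ i) := by
        refine Finset.prod_le_prod (fun _ _ => norm_nonneg _) fun i _ => ?_
        refine (norm_sub_le _ _).trans_eq ?_
        simp [Real.norm_of_nonneg hq0.le]
    _ ≤ Real.exp (∑ i ∈ s, ‖a‖ * q ^ i) :=
        Real.prod_one_add_le_exp_sum _ fun i => by positivity
    _ ≤ Real.exp (‖a‖ / (1 - q)) := by
        rw [Real.exp_le_exp, div_eq_mul_inv, ← tsum_geometric_of_lt_one hq0.le hq1, ← tsum_mul_left]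
        exact ((summable_geometric_of_lt_one hq0.le hq1).mul_left _).sum_le_tsum _
          fun i _ => by positivity

lemma continuous_qPochInf {q : ℝ} (hq0 : 0 < q) (hq1 : q < 1) :
    Continuous fun a : ℂ => qPochInf a q := by
  rw [continuous_iff_continuousAt]
  intro a
  have hK : IsCompact (Metric.closedBall (0 : ℂ) (‖a‖ + 1)) := isCompact_closedBall _ _
  have hprod := Summable.hasProdUniformlyOn_nat_one_add (f := fun (n : ℕ) (z : ℂ) => -(z * (q : ℂ) ^ n))
    hK (u := fun n => (‖a‖ + 1) * q ^ n) ((summable_geometric_of_lt_one hq0.le hq1).mul_left _)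
    (Eventually.of_forall fun n z hz => ?_) (fun n => by fun_prop)
  · have hc := (hasProdUniformlyOn_iff_tendstoUniformlyOn.mp hprod).continuousOn
      (Frequently.of_forall fun s => by fun_prop)
    refine ContinuousOn.continuousAt (s := Metric.closedBall (0 : ℂ) (‖a‖ + 1)) ?_
      (Metric.closedBall_mem_nhds_of_mem (by simp))
    simpa only [qPochInf, sub_eq_add_neg] using hc
  · simp only [norm_neg, norm_mul, norm_pow, Complex.norm_real, Real.norm_of_nonneg hq0.le]
    gcongr
    simpa using hz

/-- Growth of `(z; q)_∞` along `z, z / q, z / q ^ 2, …`. -/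
lemma norm_qPochInf_div_pow_le {q : ℝ} (hq0 : 0 < q) (hq1 : q < 1) {z : ℂ} {R : ℝ} (hR : 0 < R)
    (hz : ‖z‖ ≤ R) (n : ℕ) :
    ‖qPochInf (z / (q : ℂ) ^ n) q‖ * q ^ (∑ i ∈ Finset.range n, (i + 1)) ≤
      Real.exp ((R + R⁻¹) / (1 - q)) * R ^ n := by
  have h1q : 0 < 1 - q := by linarith
  have key : ‖qPochInf (z / (q : ℂ) ^ n) q‖ * q ^ (∑ i ∈ Finset.range n, (i + 1)) ≤
      Real.exp (R / (1 - q)) * R ^ n * ∏ i ∈ Finset.range n, (1 + R⁻¹ * q ^ i) := by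
    induction n with
    | zero =>
      simpa using (norm_qPochInf_le hq0 hq1 z).trans (by gcongr)
    | succ n ih =>
      have hqC : (q : ℂ) ≠ 0 := by exact_mod_cast hq0.ne'
      have h1 : z / (q : ℂ) ^ (n + 1) * q = z / (q : ℂ) ^ n := by
        rw [pow_succ, ← div_div, div_mul_cancel₀ _ hqC]
      have h2 : ‖1 - z / (q : ℂ) ^ (n + 1)‖ * q ^ (n + 1) ≤ R * (1 + R⁻¹ * q ^ n) := by
        have : ‖1 - z / (q : ℂ) ^ (n + 1)‖ ≤ 1 + R / q ^ (n + 1) := by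
          refine (norm_sub_le _ _).trans ?_
          simp only [norm_one, norm_div, norm_pow, Complex.norm_real, Real.norm_of_nonneg hq0.le]
          gcongr
        calc ‖1 - z / (q : ℂ) ^ (n + 1)‖ * q ^ (n + 1) ≤ (1 + R / q ^ (n + 1)) * q ^ (n + 1) := by
              gcongr
          _ = q ^ (n + 1) + R := by field_simp
          -- Lowering the exponent to `n` lets the correction factors `1 + R⁻¹ * q ^ i` start at `i
          -- = 0`, matching the full geometric series.
          _ ≤ q ^ n + R := by
              gcongr ?_ + R
              exact pow_le_pow_of_le_one hq0.le hq1.le (Nat.le_succ n)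
          _ = R * (1 + R⁻¹ * q ^ n) := by
            rw [mul_add, mul_one, mul_inv_cancel_left₀ hR.ne', add_comm]
      rw [qPochInf_eq_one_sub_mul hq0 hq1, h1, norm_mul, Finset.sum_range_succ, pow_add q,
        Finset.prod_range_succ]
      calc _ = (‖1 - z / (q : ℂ) ^ (n + 1)‖ * q ^ (n + 1)) *
            (‖qPochInf (z / (q : ℂ) ^ n) q‖ * q ^ (∑ i ∈ Finset.range n, (i + 1))) := by ring
        _ ≤ (R * (1 + R⁻¹ * q ^ n)) * (Real.exp (R / (1 - q)) * R ^ n *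
            ∏ i ∈ Finset.range n, (1 + R⁻¹ * q ^ i)) := by gcongr
        _ = _ := by ring
  refine key.trans ?_
  have h3 : ∏ i ∈ Finset.range n, (1 + R⁻¹ * q ^ i) ≤ Real.exp (R⁻¹ / (1 - q)) := by
    refine (Real.prod_one_add_le_exp_sum _ fun i => by positivity).trans ?_
    rw [Real.exp_le_exp, div_eq_mul_inv, ← tsum_geometric_of_lt_one hq0.le hq1, ← tsum_mul_left]
    exact ((summable_geometric_of_lt_one hq0.le hq1).mul_left _).sum_le_tsum _
      fun i _ => by positivity
  calc _ ≤ Real.exp (R / (1 - q)) * R ^ n * Real.exp (R⁻¹ / (1 - q)) := by gcongr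
    _ = _ := by rw [add_div, Real.exp_add, mul_right_comm]

/-! ### Convergence of the bilateral series -/

/-- The `n`-th term of the bilateral series
`∑ (-1)^n a^n q^(n^2) (a b q^n, b q^(-n), a d q^n, d q^(-n); q)_∞`. -/
noncomputable def bilateralTerm (q : ℝ) (a b d : ℂ) (n : ℤ) : ℂ :=
  (-1) ^ n * a ^ n * (q : ℂ) ^ (n ^ 2) *
    (qPochInf (a * b * (q : ℂ) ^ n) q * qPochInf (b * (q : ℂ) ^ (-n)) q *
      qPochInf (a * d * (q : ℂ) ^ n) q * qPochInf (d * (q : ℂ) ^ (-n)) q)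

/-- The constant in the geometric bound of `bilateralTerm`. -/
noncomputable def bilateralBound (q A R S : ℝ) : ℝ :=
  Real.exp ((R + R⁻¹ + (S + S⁻¹) + (A * R + (A * R)⁻¹) + (A * S + (A * S)⁻¹)) / (1 - q))

/-- Reflecting `n` exchanges `b` with `a * b` and `d` with `a * d`. Since `a⁻¹ * (a * b) * (a * d) =
a * b * d`, the decay ratio is unchanged, so estimates for `n ≥ 0` suffice. -/
lemma bilateralTerm_neg {q : ℝ} {a : ℂ} (ha : a ≠ 0) (b d : ℂ) (n : ℤ) :
    bilateralTerm q a b d (-n) = bilateralTerm q a⁻¹ (a * b) (a * d) n := by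
  have h : ((-1 : ℂ) ^ n)⁻¹ = (-1) ^ n := by rw [← inv_zpow, inv_neg, inv_one]
  simp only [bilateralTerm, neg_neg, inv_mul_cancel_left₀ ha, neg_sq, zpow_neg (-1 : ℂ),
    zpow_neg a, inv_zpow a, h]
  ring

lemma bilateralTerm_swap (q : ℝ) (a b d : ℂ) (n : ℤ) :
    bilateralTerm q a b d n = bilateralTerm q a d b n := by
  simp only [bilateralTerm]; ring

lemma norm_bilateralTerm_natCast_le {q : ℝ} (hq0 : 0 < q) (hq1 : q < 1) {a b d : ℂ} {A R S : ℝ}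
    (hA : 0 < A) (hR : 0 < R) (hS : 0 < S) (ha : ‖a‖ = A) (hb : ‖b‖ ≤ R) (hd : ‖d‖ ≤ S) (n : ℕ) :
    ‖bilateralTerm q a b d n‖ ≤ bilateralBound q A R S * (A * R * S / q) ^ n := by
  have h1q : 0 < 1 - q := by linarith
  set s := ∑ i ∈ Finset.range n, (i + 1) with hs
  have hs2 : s + s = n ^ 2 + n := by
    have := Finset.sum_range_id_mul_two (n + 1)
    rw [Finset.sum_range_succ'] at this
    simp only [add_zero, Nat.add_sub_cancel, ← hs] at this
    linarith
  -- The factors in `b` and `d` each grow like `q ^ (-s)`; together they use up the Gaussian and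
  -- leave `q ^ (-n)`, whence the division by `q` in the ratio.
  have hpow : q ^ (n ^ 2) = q ^ s * q ^ s / q ^ n := by
    rw [← pow_add, hs2, pow_add, mul_div_cancel_right₀ _ (by positivity)]
  have e1 : ∀ z : ℂ, ∀ T : ℝ, ‖z‖ ≤ T →
      ‖qPochInf (a * z * (q : ℂ) ^ n) q‖ ≤ Real.exp (A * T / (1 - q)) := by
    intro z T hz
    refine (norm_qPochInf_le hq0 hq1 _).trans ?_
    rw [Real.exp_le_exp]
    gcongr
    rw [norm_mul, norm_mul, norm_pow, Complex.norm_real, Real.norm_of_nonneg hq0.le, ha]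
    calc A * ‖z‖ * q ^ n ≤ A * T * 1 := by
          have hT : 0 ≤ T := (norm_nonneg _).trans hz
          gcongr
          exact pow_le_one₀ hq0.le hq1.le
      _ = A * T := mul_one _
  have hb' := norm_qPochInf_div_pow_le hq0 hq1 hR hb n
  have hd' := norm_qPochInf_div_pow_le hq0 hq1 hS hd n
  rw [← hs] at hb' hd'
  simp only [bilateralTerm, zpow_natCast, zpow_neg, ← div_eq_mul_inv, norm_mul, norm_pow, norm_neg,
    norm_one, one_pow, one_mul, ha, ← Nat.cast_pow, Complex.norm_real, Real.norm_of_nonneg hq0.le]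
  rw [hpow]
  calc _ = (A / q) ^ n * (‖qPochInf (a * b * (q : ℂ) ^ n) q‖ * ‖qPochInf (a * d * (q : ℂ) ^ n) q‖ *
        ((‖qPochInf (b / (q : ℂ) ^ n) q‖ * q ^ s) * (‖qPochInf (d / (q : ℂ) ^ n) q‖ * q ^ s))) := by
        rw [div_pow]; ring
    _ ≤ (A / q) ^ n * (Real.exp (A * R / (1 - q)) * Real.exp (A * S / (1 - q)) *
        ((Real.exp ((R + R⁻¹) / (1 - q)) * R ^ n) * (Real.exp ((S + S⁻¹) / (1 - q)) * S ^ n))) := by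
        gcongr
        · exact e1 b R hb
        · exact e1 d S hd
    _ = Real.exp ((R + R⁻¹ + (S + S⁻¹) + A * R + A * S) / (1 - q)) * (A * R * S / q) ^ n := by
        rw [show A * R * S / q = A / q * (R * S) by ring, mul_pow, mul_pow]
        simp only [add_div, Real.exp_add]
        ring
    -- The added inverses make the constant invariant under the reflection of `bilateralTerm_neg`.
    _ ≤ _ := by
        rw [bilateralBound]
        have h1 : 0 < (A * R)⁻¹ := by positivity
        have h2 : 0 < (A * S)⁻¹ := by positivity
        refine mul_le_mul_of_nonneg_right (Real.exp_le_exp.mpr ?_) (by positivity)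
        exact div_le_div_of_nonneg_right (by linarith) h1q.le

lemma norm_bilateralTerm_le {q : ℝ} (hq0 : 0 < q) (hq1 : q < 1) {a b d : ℂ} {A R S : ℝ}
    (hA : 0 < A) (hR : 0 < R) (hS : 0 < S) (ha : ‖a‖ = A) (hb : ‖b‖ ≤ R) (hd : ‖d‖ ≤ S) (n : ℤ) :
    ‖bilateralTerm q a b d n‖ ≤ bilateralBound q A R S * (A * R * S / q) ^ n.natAbs := by
  obtain ⟨m, rfl | rfl⟩ := n.eq_nat_or_neg
  · simpa using norm_bilateralTerm_natCast_le hq0 hq1 hA hR hS ha hb hd m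
  · have ha0 : a ≠ 0 := by rintro rfl; simp at ha; exact hA.ne ha
    rw [bilateralTerm_neg ha0]
    have h := norm_bilateralTerm_natCast_le hq0 hq1 (a := a⁻¹) (b := a * b) (d := a * d)
      (A := A⁻¹) (R := A * R) (S := A * S) (by positivity) (by positivity) (by positivity)
      (by rw [norm_inv, ha]) (by rw [norm_mul, ha]; gcongr) (by rw [norm_mul, ha]; gcongr) m
    have e : A⁻¹ * (A * R) * (A * S) / q = A * R * S / q := by field_simp
    have e2 : bilateralBound q A⁻¹ (A * R) (A * S) = bilateralBound q A R S := by
      simp only [bilateralBound, inv_mul_cancel_left₀ hA.ne']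
      congr 2; ring
    rw [e, e2] at h
    simpa using h

lemma summable_pow_natAbs {ρ : ℝ} (h0 : 0 ≤ ρ) (h1 : ρ < 1) : Summable fun n : ℤ => ρ ^ n.natAbs := by
  refine Summable.of_nat_of_neg ?_ ?_ <;> simpa using summable_geometric_of_lt_one h0 h1

/-- The constant involves `R⁻¹` and `S⁻¹`, while `b` or `d` may vanish; the strict inequality leaves
room to enlarge both radii. -/
lemma exists_pos_bounds {q A : ℝ} {r s : ℝ} (hr : 0 ≤ r) (hs : 0 ≤ s)
    (h : A * r * s / q < 1) : ∃ R S, 0 < R ∧ 0 < S ∧ r ≤ R ∧ s ≤ S ∧ A * R * S / q < 1 := by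
  have hc : Tendsto (fun ε : ℝ => A * (r + ε) * (s + ε) / q) (𝓝[>] 0) (𝓝 (A * r * s / q)) := by
    refine Tendsto.mono_left ?_ nhdsWithin_le_nhds
    have : Continuous fun ε : ℝ => A * (r + ε) * (s + ε) / q := by fun_prop
    simpa using this.tendsto 0
  obtain ⟨ε, h1, h2⟩ := ((hc.eventually_lt_const h).and self_mem_nhdsWithin).exists
  have h2 : 0 < ε := h2
  exact ⟨r + ε, s + ε, by linarith, by linarith, by linarith, by linarith, h1⟩

lemma summable_norm_bilateralTerm {q : ℝ} (hq0 : 0 < q) (hq1 : q < 1) {a b d : ℂ} (ha : a ≠ 0)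
    (h : ‖a * b * d / q‖ < 1) : Summable fun n => ‖bilateralTerm q a b d n‖ := by
  have hA : 0 < ‖a‖ := norm_pos_iff.mpr ha
  rw [norm_div, norm_mul, norm_mul, Complex.norm_real, Real.norm_of_nonneg hq0.le] at h
  obtain ⟨R, S, hR, hS, hb, hd, hlt⟩ := exists_pos_bounds (norm_nonneg b) (norm_nonneg d) h
  exact Summable.of_nonneg_of_le (fun _ => norm_nonneg _)
    (norm_bilateralTerm_le hq0 hq1 hA hR hS rfl hb hd)
    ((summable_pow_natAbs (by positivity) hlt).mul_left _)

/-! ### Contiguous relation and removal of a parameter -/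

/-- After the common infinite products are split off, this is a rational identity in `q ^ n`. The
differenced series has parameters `a / q`, `b * q`, `d`, hence the same ratio `a * b * d / q`, so it
converges under the same hypothesis and its differences sum to zero. -/
lemma bilateralTerm_telescope {q : ℝ} (hq0 : 0 < q) (hq1 : q < 1) {a : ℂ} (ha : a ≠ 0) (b d : ℂ)
    (n : ℤ) :
    (1 + a * b * d / q) * bilateralTerm q a b d n -
        (1 - a * b * d / q) * (1 - a * b ^ 2) * bilateralTerm q a (b * q) d n =
      b * bilateralTerm q (a / q) (b * q) d (n + 1) - b * bilateralTerm q (a / q) (b * q) d n := by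
  have hq : (q : ℂ) ≠ 0 := by exact_mod_cast hq0.ne'
  have hy : (q : ℂ) ^ n ≠ 0 := zpow_ne_zero _ hq
  have hsq : (q : ℂ) ^ ((n + 1) ^ 2) = (q : ℂ) ^ (n ^ 2) * ((q : ℂ) ^ n) ^ 2 * q := by
    rw [show (n + 1) ^ 2 = n ^ 2 + n + n + 1 by ring, zpow_add₀ hq, zpow_add₀ hq, zpow_add₀ hq,
      zpow_one]
    ring
  simp only [bilateralTerm, hsq, zpow_add₀ (neg_ne_zero.mpr (one_ne_zero (α := ℂ))),
    zpow_add₀ (div_ne_zero ha hq), zpow_add₀ hq, div_zpow, zpow_neg, zpow_one]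
  set y := (q : ℂ) ^ n
  rw [show a / q * (b * q) * y = a * b * y by field_simp,
    show a / q * d * (y * q) = a * d * y by field_simp,
    show a / q * (b * q) * (y * q) = a * b * y * q by field_simp,
    show b * q * (y * q)⁻¹ = b * y⁻¹ by field_simp,
    show a * (b * q) * y = a * b * y * q by ring,
    show b * q * y⁻¹ = b * y⁻¹ * q by ring,
    qPochInf_eq_one_sub_mul hq0 hq1 (a * b * y), qPochInf_eq_one_sub_mul hq0 hq1 (b * y⁻¹),
    qPochInf_eq_one_sub_mul hq0 hq1 (a / q * d * y),
    qPochInf_eq_one_sub_mul hq0 hq1 (d * (y * q)⁻¹),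
    show a / q * d * y * q = a * d * y by field_simp,
    show d * (y * q)⁻¹ * q = d * y⁻¹ by field_simp]
  generalize qPochInf (a * b * y * q) q = P1
  generalize qPochInf (b * y⁻¹ * q) q = P2
  generalize qPochInf (a * d * y) q = P3
  generalize qPochInf (d * y⁻¹) q = P4
  field_simp
  ring

lemma tsum_comp_add_one_sub {f : ℤ → ℂ} (hf : Summable f) : ∑' n, (f (n + 1) - f n) = 0 := by
  have h1 : Summable fun n => f (n + 1) := (Equiv.addRight (1 : ℤ)).summable_iff.mpr hf
  rw [h1.tsum_sub hf, sub_eq_zero]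
  exact (Equiv.addRight (1 : ℤ)).tsum_eq f

lemma tsum_bilateralTerm_step {q : ℝ} (hq0 : 0 < q) (hq1 : q < 1) {a b d : ℂ} (ha : a ≠ 0)
    (h : ‖a * b * d / q‖ < 1) :
    (1 + a * b * d / q) * ∑' n, bilateralTerm q a b d n =
      (1 - a * b * d / q) * (1 - a * b ^ 2) * ∑' n, bilateralTerm q a (b * q) d n := by
  have hq : (q : ℂ) ≠ 0 := by exact_mod_cast hq0.ne'
  have h1 := (summable_norm_bilateralTerm hq0 hq1 ha h).of_norm
  have h2 : Summable (bilateralTerm q a (b * q) d) := by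
    refine (summable_norm_bilateralTerm hq0 hq1 ha ?_).of_norm
    rw [show a * (b * q) * d / q = a * b * d / q * q by ring, norm_mul, Complex.norm_real,
      Real.norm_of_nonneg hq0.le]
    exact mul_lt_one_of_nonneg_of_lt_one_left (norm_nonneg _) h hq1.le
  have h3 : Summable (bilateralTerm q (a / q) (b * q) d) := by
    refine (summable_norm_bilateralTerm hq0 hq1 (div_ne_zero ha hq) ?_).of_norm
    rwa [show a / q * (b * q) * d / q = a * b * d / q by field_simp]
  rw [← sub_eq_zero, ← tsum_mul_left, ← tsum_mul_left, ← (h1.mul_left _).tsum_sub (h2.mul_left _)]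
  simp_rw [bilateralTerm_telescope hq0 hq1 ha]
  exact tsum_comp_add_one_sub (h3.mul_left b)

lemma tendsto_prod_qPochInf {q : ℝ} (hq0 : 0 < q) (hq1 : q < 1) (a : ℂ) :
    Tendsto (fun N => ∏ i ∈ Finset.range N, (1 - a * (q : ℂ) ^ i)) atTop (𝓝 (qPochInf a q)) :=
  (multipliable_qPochInf hq0 hq1 a).tendsto_prod_tprod_nat

lemma tsum_bilateralTerm_eq_zero_param {q : ℝ} (hq0 : 0 < q) (hq1 : q < 1) {a b d : ℂ}
    (ha : a ≠ 0) (h : ‖a * b * d / q‖ < 1) :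
    qPochInf (-(a * b * d / q)) q * ∑' n, bilateralTerm q a b d n =
      qPochInf (a * b * d / q) q * qPochInf (a * b ^ 2) (q ^ 2) *
        ∑' n, bilateralTerm q a 0 d n := by
  have hqn : ∀ N : ℕ, ‖(q : ℂ) ^ N‖ ≤ 1 := fun N => by
    rw [norm_pow, Complex.norm_real, Real.norm_of_nonneg hq0.le]
    exact pow_le_one₀ hq0.le hq1.le
  have key : ∀ N : ℕ, (∏ i ∈ Finset.range N, (1 - -(a * b * d / q) * (q : ℂ) ^ i)) *
      ∑' n, bilateralTerm q a b d n = (∏ i ∈ Finset.range N, (1 - a * b * d / q * (q : ℂ) ^ i)) *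
      (∏ i ∈ Finset.range N, (1 - a * b ^ 2 * ((q ^ 2 : ℝ) : ℂ) ^ i)) *
      ∑' n, bilateralTerm q a (b * (q : ℂ) ^ N) d n := by
    intro N
    induction N with
    | zero => simp
    | succ N ih =>
      have hN : ‖a * (b * (q : ℂ) ^ N) * d / q‖ < 1 := by
        rw [show a * (b * (q : ℂ) ^ N) * d / q = a * b * d / q * (q : ℂ) ^ N by ring, norm_mul]
        exact mul_lt_one_of_nonneg_of_lt_one_left (norm_nonneg _) h (hqn N)
      have hstep := tsum_bilateralTerm_step hq0 hq1 ha hN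
      rw [Finset.prod_range_succ, Finset.prod_range_succ, Finset.prod_range_succ,
        pow_succ (q : ℂ) N, ← mul_assoc b]
      push_cast at ih ⊢
      linear_combination (1 - -(a * b * d / q) * (q : ℂ) ^ N) * ih +
        (∏ i ∈ Finset.range N, (1 - a * b * d / q * (q : ℂ) ^ i)) *
        (∏ i ∈ Finset.range N, (1 - a * b ^ 2 * ((q : ℂ) ^ 2) ^ i)) * hstep
  -- As `‖b * q ^ N‖ ≤ ‖b‖`, one geometric majorant serves every `N`.
  have hlim : Tendsto (fun N : ℕ => ∑' n, bilateralTerm q a (b * (q : ℂ) ^ N) d n) atTop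
      (𝓝 (∑' n, bilateralTerm q a 0 d n)) := by
    have hA : 0 < ‖a‖ := norm_pos_iff.mpr ha
    have h' := h
    rw [norm_div, norm_mul, norm_mul, Complex.norm_real, Real.norm_of_nonneg hq0.le] at h'
    obtain ⟨R, S, hR, hS, hb, hd, hlt⟩ :=
      exists_pos_bounds (norm_nonneg b) (norm_nonneg d) h'
    refine tendsto_tsum_of_dominated_convergence
      (bound := fun n : ℤ => bilateralBound q ‖a‖ R S * (‖a‖ * R * S / q) ^ n.natAbs)
      ((summable_pow_natAbs (by positivity) hlt).mul_left _) (fun n => ?_)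
      (Eventually.of_forall fun N n => norm_bilateralTerm_le hq0 hq1 hA hR hS rfl ?_ hd n)
    · have hc : Continuous fun z : ℂ => bilateralTerm q a z d n := by
        have := continuous_qPochInf hq0 hq1
        unfold bilateralTerm
        fun_prop
      have hz : Tendsto (fun N : ℕ => b * (q : ℂ) ^ N) atTop (𝓝 0) := by
        have : Tendsto (fun N : ℕ => (q : ℂ) ^ N) atTop (𝓝 0) :=
          tendsto_pow_atTop_nhds_zero_of_norm_lt_one (by
            rwa [Complex.norm_real, Real.norm_of_nonneg hq0.le])
        simpa using this.const_mul b
      exact (hc.tendsto 0).comp hz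
    · rw [norm_mul]
      exact (mul_le_of_le_one_right (norm_nonneg _) (hqn N)).trans hb
  have hq2 : q ^ 2 < 1 := by nlinarith
  refine tendsto_nhds_unique ((tendsto_prod_qPochInf hq0 hq1 _).mul_const _) ?_
  simp_rw [key]
  exact ((tendsto_prod_qPochInf hq0 hq1 _).mul
    (tendsto_prod_qPochInf (by positivity) hq2 _)).mul hlim

/-! ### Jacobi's triple product through a terminating form -/

lemma qPochInf_zpow_of_nonpos {p : ℝ} (hp : 0 < p) {m : ℤ} (hm : m ≤ 0) :
    qPochInf ((p : ℂ) ^ m) p = 0 := by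
  obtain ⟨k, hk⟩ := Int.eq_ofNat_of_zero_le (neg_nonneg.mpr hm)
  have hpC : (p : ℂ) ≠ 0 := by exact_mod_cast hp.ne'
  refine tprod_of_exists_eq_zero ⟨k, ?_⟩
  rw [← zpow_natCast (p : ℂ) k, ← zpow_add₀ hpC, show m + (k : ℤ) = 0 by omega, zpow_zero, sub_self]

/-- The `n`-th term of the bilateral form of the finite Jacobi triple product. -/
noncomputable def tripleTerm (q : ℝ) (a b : ℂ) (n : ℤ) : ℂ :=
  (-1) ^ n * a ^ n * (q : ℂ) ^ (n ^ 2) *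
    (qPochInf (b * ((q : ℂ) ^ n) ^ 2) (q ^ 2) * qPochInf (b * (((q : ℂ) ^ n) ^ 2)⁻¹) (q ^ 2))

/-- `g` is a telescoping certificate: a Laurent polynomial in `q ^ m` times the shifted term. At `b
= q ^ (2 * (N + 1))` it yields the recurrence from `N` to `N + 1`. -/
lemma tripleTerm_telescope {q : ℝ} (hq0 : 0 < q) (hq1 : q < 1) {a : ℂ} (ha : a ≠ 0) (b : ℂ)
    (n : ℤ) {g : ℤ → ℂ} (hg : g = fun m : ℤ =>
      (-(b / (a * q) * (1 - a * b / q)) - b * (1 - b / (a * q)) * (((q : ℂ) ^ m) ^ 2)⁻¹) *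
        (1 - b * ((q : ℂ) ^ m) ^ 2) * tripleTerm q a (b * q ^ 2) m) :
    (1 - b ^ 2 / q ^ 2) * (1 - b ^ 2) * tripleTerm q a (b * q ^ 2) n -
        (1 - a * b / q) * (1 - b / (a * q)) * tripleTerm q a b n = g (n + 1) - g n := by
  have hq : (q : ℂ) ≠ 0 := by exact_mod_cast hq0.ne'
  have hy : (q : ℂ) ^ n ≠ 0 := zpow_ne_zero _ hq
  have hq2 : (0 : ℝ) < q ^ 2 := by positivity
  have hq2' : q ^ 2 < 1 := by nlinarith
  have hsq : (q : ℂ) ^ ((n + 1) ^ 2) = (q : ℂ) ^ (n ^ 2) * ((q : ℂ) ^ n) ^ 2 * q := by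
    rw [show (n + 1) ^ 2 = n ^ 2 + n + n + 1 by ring, zpow_add₀ hq, zpow_add₀ hq, zpow_add₀ hq,
      zpow_one]
    ring
  have step : ∀ z : ℂ, qPochInf z (q ^ 2) = (1 - z) * qPochInf (z * q ^ 2) (q ^ 2) := by
    intro z; rw [qPochInf_eq_one_sub_mul hq2 hq2']; push_cast; rfl
  subst hg
  simp only [tripleTerm, hsq, zpow_add₀ (neg_ne_zero.mpr (one_ne_zero (α := ℂ))),
    zpow_add₀ ha, zpow_add₀ hq, zpow_one]
  set y := (q : ℂ) ^ n
  rw [show b * (q : ℂ) ^ 2 * ((y * q) ^ 2)⁻¹ = b * (y ^ 2)⁻¹ by field_simp,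
    step (b * y ^ 2), step (b * (y ^ 2)⁻¹), step (b * q ^ 2 * y ^ 2),
    show b * (q : ℂ) ^ 2 * (y * q) ^ 2 = b * q ^ 2 * y ^ 2 * q ^ 2 by ring,
    show b * y ^ 2 * (q : ℂ) ^ 2 = b * q ^ 2 * y ^ 2 by ring,
    show b * (q : ℂ) ^ 2 * (y ^ 2)⁻¹ = b * (y ^ 2)⁻¹ * q ^ 2 by ring, step (b * q ^ 2 * y ^ 2)]
  generalize qPochInf (b * q ^ 2 * y ^ 2 * q ^ 2) (q ^ 2) = P1
  generalize qPochInf (b * (y ^ 2)⁻¹ * q ^ 2) (q ^ 2) = P2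
  field_simp
  ring

/-- For `|n| > N` one of the exponents `N + 1 ± n` is nonpositive, so one product contains a zero
factor. All sums over `n` are therefore finite. -/
lemma tripleTerm_eq_zero {q : ℝ} (hq0 : 0 < q) (a : ℂ) {N : ℕ} {n : ℤ}
    (hn : (N : ℤ) < n.natAbs) : tripleTerm q a (((q ^ 2 : ℝ) : ℂ) ^ (N + 1)) n = 0 := by
  have hp : (0 : ℝ) < q ^ 2 := by positivity
  have hpC : ((q ^ 2 : ℝ) : ℂ) ≠ 0 := by exact_mod_cast hp.ne'
  have e : ((q : ℂ) ^ n) ^ 2 = ((q ^ 2 : ℝ) : ℂ) ^ n := by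
    push_cast; rw [← zpow_natCast, ← zpow_natCast, ← zpow_mul, ← zpow_mul, mul_comm]
  rw [tripleTerm, e, ← zpow_natCast, ← zpow_neg, ← zpow_add₀ hpC, ← zpow_add₀ hpC]
  rcases le_or_gt 0 n with h | h
  · rw [qPochInf_zpow_of_nonpos hp (m := ((N + 1 : ℕ) : ℤ) + -n) (by push_cast; omega)]
    ring
  · rw [qPochInf_zpow_of_nonpos hp (m := ((N + 1 : ℕ) : ℤ) + n) (by push_cast; omega)]
    ring

lemma summable_of_tripleTerm_mul {q : ℝ} (hq0 : 0 < q) (a : ℂ) (N : ℕ) (f : ℤ → ℂ) :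
    Summable fun n => f n * tripleTerm q a (((q ^ 2 : ℝ) : ℂ) ^ (N + 1)) n := by
  refine summable_of_ne_finset_zero (s := Finset.Icc (-(N : ℤ)) N) fun n hn => ?_
  rw [tripleTerm_eq_zero hq0, mul_zero]
  rw [Finset.mem_Icc] at hn
  omega

lemma tsum_tripleTerm_step {q : ℝ} (hq0 : 0 < q) (hq1 : q < 1) {a : ℂ} (ha : a ≠ 0) (N : ℕ) :
    (1 - ((q ^ 2 : ℝ) : ℂ) * ((q ^ 2 : ℝ) : ℂ) ^ (2 * N)) *
        (1 - ((q ^ 2 : ℝ) : ℂ) * ((q ^ 2 : ℝ) : ℂ) ^ (2 * N + 1)) *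
        ∑' n, tripleTerm q a (((q ^ 2 : ℝ) : ℂ) ^ (N + 1 + 1)) n =
      (1 - a * q * ((q ^ 2 : ℝ) : ℂ) ^ N) * (1 - q / a * ((q ^ 2 : ℝ) : ℂ) ^ N) *
        ∑' n, tripleTerm q a (((q ^ 2 : ℝ) : ℂ) ^ (N + 1)) n := by
  have hq : (q : ℂ) ≠ 0 := by exact_mod_cast hq0.ne'
  set p : ℂ := ((q ^ 2 : ℝ) : ℂ) with hp
  have hpq : p = (q : ℂ) ^ 2 := by rw [hp]; push_cast; rfl
  have h0 : ∀ M : ℕ, Summable (tripleTerm q a (p ^ (M + 1))) := fun M => by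
    simpa only [Pi.one_apply, one_mul] using summable_of_tripleTerm_mul hq0 a M 1
  have ht := fun n => tripleTerm_telescope hq0 hq1 ha (p ^ (N + 1)) n rfl
  simp only [← hpq, ← pow_succ] at ht
  have hs := tsum_comp_add_one_sub (summable_of_tripleTerm_mul hq0 a (N + 1) fun m : ℤ =>
      (-(p ^ (N + 1) / (a * q) * (1 - a * p ^ (N + 1) / q)) -
        p ^ (N + 1) * (1 - p ^ (N + 1) / (a * q)) * (((q : ℂ) ^ m) ^ 2)⁻¹) *
        (1 - p ^ (N + 1) * ((q : ℂ) ^ m) ^ 2))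
  rw [← hp] at hs
  simp_rw [← ht] at hs
  rw [((h0 (N + 1)).mul_left _).tsum_sub ((h0 N).mul_left _), tsum_mul_left, tsum_mul_left,
    sub_eq_zero] at hs
  have hpq' : p / q = q := by rw [hpq]; field_simp
  have hp0 : p ≠ 0 := by rw [hpq]; exact pow_ne_zero 2 hq
  have e1 : (p ^ (N + 1)) ^ 2 / p = p * p ^ (2 * N) := by rw [div_eq_iff hp0]; ring
  have e2 : (p ^ (N + 1)) ^ 2 = p * p ^ (2 * N + 1) := by ring
  have e3 : a * p ^ (N + 1) / q = a * q * p ^ N := by linear_combination a * p ^ N * hpq'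
  have e4 : p ^ (N + 1) / (a * q) = q / a * p ^ N := by linear_combination p ^ N / a * hpq'
  rw [e1, e2, e3, e4] at hs
  exact hs

lemma tsum_tripleTerm_zero {q : ℝ} (hq0 : 0 < q) (a : ℂ) :
    ∑' n, tripleTerm q a ((q ^ 2 : ℝ) : ℂ) n = qPochInf ((q ^ 2 : ℝ) : ℂ) (q ^ 2) ^ 2 := by
  rw [tsum_eq_single 0 fun n hn => ?_]
  · simp [tripleTerm]; ring
  · have := tripleTerm_eq_zero hq0 a (N := 0) (n := n) (by rw [Nat.cast_zero]; omega)
    simpa only [zero_add, pow_one] using this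

/-- Jacobi's triple product identity, in terms of the degenerate bilateral series. -/
lemma tsum_bilateralTerm_zero_zero {q : ℝ} (hq0 : 0 < q) (hq1 : q < 1) {a : ℂ} (ha : a ≠ 0) :
    ∑' n, bilateralTerm q a 0 0 n = qPochInf ((q ^ 2 : ℝ) : ℂ) (q ^ 2) *
      qPochInf (a * q) (q ^ 2) * qPochInf (q / a) (q ^ 2) := by
  have hp : (0 : ℝ) < q ^ 2 := by positivity
  have hp1 : q ^ 2 < 1 := by nlinarith
  have hpn : ‖((q ^ 2 : ℝ) : ℂ)‖ < 1 := by rwa [Complex.norm_real, Real.norm_of_nonneg hp.le]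
  set p : ℂ := ((q ^ 2 : ℝ) : ℂ) with hpdef
  have key : ∀ N : ℕ, (∏ i ∈ Finset.range (2 * N), (1 - p * p ^ i)) *
      ∑' n, tripleTerm q a (p ^ (N + 1)) n = (∏ i ∈ Finset.range N, (1 - a * q * p ^ i)) *
      (∏ i ∈ Finset.range N, (1 - q / a * p ^ i)) * qPochInf p (q ^ 2) ^ 2 := by
    intro N
    induction N with
    | zero => simpa [-Complex.ofReal_pow, p] using tsum_tripleTerm_zero hq0 a
    | succ N ih =>
      have hs := tsum_tripleTerm_step hq0 hq1 ha N
      rw [← hpdef] at hs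
      rw [show 2 * (N + 1) = 2 * N + 1 + 1 by ring, Finset.prod_range_succ, Finset.prod_range_succ,
        Finset.prod_range_succ, Finset.prod_range_succ]
      linear_combination (∏ i ∈ Finset.range (2 * N), (1 - p * p ^ i)) * hs +
        (1 - a * q * p ^ N) * (1 - q / a * p ^ N) * ih
  have hlim : Tendsto (fun N : ℕ => ∑' n, tripleTerm q a (p ^ (N + 1)) n) atTop
      (𝓝 (∑' n, bilateralTerm q a 0 0 n)) := by
    have hsum := summable_norm_bilateralTerm hq0 hq1 (b := 0) (d := 0) ha (by simp)
    have hE : 0 < Real.exp (1 / (1 - q ^ 2)) := Real.exp_pos _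
    refine tendsto_tsum_of_dominated_convergence
      (bound := fun n : ℤ => Real.exp (1 / (1 - q ^ 2)) ^ 2 * ‖bilateralTerm q a 0 0 n‖)
      (hsum.mul_left _) (fun n => ?_) (Eventually.of_forall fun N n => ?_)
    · have hc : Continuous fun z : ℂ => tripleTerm q a z n := by
        have := continuous_qPochInf hp hp1
        unfold tripleTerm
        fun_prop
      have hz : Tendsto (fun N : ℕ => p ^ (N + 1)) atTop (𝓝 0) :=
        (tendsto_pow_atTop_nhds_zero_of_norm_lt_one hpn).comp (tendsto_add_atTop_nat 1)
      have := (hc.tendsto 0).comp hz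
      simpa [tripleTerm, bilateralTerm, Function.comp_def] using this
    -- Off the support the term is zero; on it both exponents `N + 1 ± n` are nonnegative, so the
    -- two products are uniformly bounded and the theta term dominates.
    · by_cases hn : (N : ℤ) < n.natAbs
      · rw [tripleTerm_eq_zero hq0 a hn, norm_zero]; positivity
      · have hpC : p ≠ 0 := by rw [hpdef]; exact_mod_cast hp.ne'
        have e : ((q : ℂ) ^ n) ^ 2 = p ^ n := by
          rw [hpdef]; push_cast
          rw [← zpow_natCast, ← zpow_natCast, ← zpow_mul, ← zpow_mul, mul_comm]
        have hb : ∀ m : ℤ, 0 ≤ m → ‖qPochInf (p ^ m) (q ^ 2)‖ ≤ Real.exp (1 / (1 - q ^ 2)) := by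
          intro m hm
          lift m to ℕ using hm
          refine (norm_qPochInf_le hp hp1 _).trans (Real.exp_le_exp.mpr ?_)
          refine div_le_div_of_nonneg_right ?_ (by linarith)
          rw [zpow_natCast, norm_pow]
          exact pow_le_one₀ (norm_nonneg _) hpn.le
        have h1 := hb (((N + 1 : ℕ) : ℤ) + n) (by push_cast; omega)
        have h2 := hb (((N + 1 : ℕ) : ℤ) + -n) (by push_cast; omega)
        rw [tripleTerm, e, ← zpow_natCast, ← zpow_neg, ← zpow_add₀ hpC, ← zpow_add₀ hpC,
          bilateralTerm, norm_mul, norm_mul (qPochInf _ _)]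
        simp only [mul_zero, zero_mul, qPochInf_zero, mul_one]
        calc _ ≤ ‖(-1) ^ n * a ^ n * (q : ℂ) ^ n ^ 2‖ *
              (Real.exp (1 / (1 - q ^ 2)) * Real.exp (1 / (1 - q ^ 2))) := by gcongr
          _ = _ := by ring
  have hL := ((tendsto_prod_qPochInf hp hp1 p).comp
    (tendsto_id.const_mul_atTop' (show 0 < 2 by norm_num))).mul hlim
  have hR := ((tendsto_prod_qPochInf hp hp1 (a * q)).mul
    (tendsto_prod_qPochInf hp hp1 (q / a))).mul_const (qPochInf p (q ^ 2) ^ 2)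
  have hfin := tendsto_nhds_unique (hL.congr fun N => key N) hR
  exact mul_left_cancel₀ (qPochInf_ne_zero hp hp1 hpn) (by linear_combination hfin)

/-- Bailey's bilateral `q`-Kummer sum, in entire form. -/
theorem tsum_bilateralTerm {q : ℝ} (hq0 : 0 < q) (hq1 : q < 1) {a b d : ℂ} (ha : a ≠ 0)
    (h : ‖a * b * d / q‖ < 1) :
    qPochInf (-(a * b * d / q)) q * ∑' n, bilateralTerm q a b d n =
      qPochInf (a * b * d / q) q * qPochInf (a * b ^ 2) (q ^ 2) * qPochInf (a * d ^ 2) (q ^ 2) *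
        (qPochInf ((q ^ 2 : ℝ) : ℂ) (q ^ 2) *
          qPochInf (a * q) (q ^ 2) * qPochInf (q / a) (q ^ 2)) := by
  -- With one parameter already `0`, the convergence condition for removing `d` is trivial.
  have h2 := tsum_bilateralTerm_eq_zero_param hq0 hq1 (b := d) (d := 0) ha (by simp)
  simp only [mul_zero, zero_div, neg_zero, qPochInf_zero, one_mul,
    tsum_bilateralTerm_zero_zero hq0 hq1 ha] at h2
  rw [tsum_bilateralTerm_eq_zero_param hq0 hq1 ha h]
  simp_rw [bilateralTerm_swap q a 0 d]
  rw [h2]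
  ring

/-! ### Reciprocal q-gamma functions and changes of base -/

/-- Holds at the poles too: division by zero makes both sides `0` there, so no case distinction is
needed later. -/
lemma inv_qGamma (q : ℝ) (z : ℂ) :
    (qGamma q z)⁻¹ =
      qPochInf ((q : ℂ) ^ z) q / qPochInf q q * ((1 - q : ℝ) : ℂ) ^ (z - 1) := by
  rw [qGamma, mul_inv, inv_div, ← Complex.cpow_neg, neg_sub]

lemma continuous_ofReal_cpow {q : ℝ} (hq0 : 0 < q) : Continuous fun z : ℂ => (q : ℂ) ^ z :=
  continuous_id.const_cpow (Or.inl (by exact_mod_cast hq0.ne'))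

lemma continuous_inv_qGamma {q : ℝ} (hq0 : 0 < q) (hq1 : q < 1) :
    Continuous fun z : ℂ => (qGamma q z)⁻¹ := by
  have h1 := (continuous_qPochInf hq0 hq1).comp (continuous_ofReal_cpow hq0)
  have h2 := continuous_ofReal_cpow (sub_pos.mpr hq1)
  simp_rw [inv_qGamma]
  exact (h1.div_const _).mul (h2.comp (continuous_id.sub continuous_const))

lemma ofReal_sq_cpow {q : ℝ} (hq0 : 0 < q) (z : ℂ) : ((q ^ 2 : ℝ) : ℂ) ^ z = (q : ℂ) ^ (2 * z) := by
  rw [sq, Complex.ofReal_mul, Complex.mul_cpow_ofReal_nonneg hq0.le hq0.le, two_mul,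
    Complex.cpow_add _ _ (by exact_mod_cast hq0.ne')]

lemma qPochInf_neg_mul_self {q : ℝ} (hq0 : 0 < q) (hq1 : q < 1) (a : ℂ) :
    qPochInf (-a) q * qPochInf a q = qPochInf (a ^ 2) (q ^ 2) := by
  rw [qPochInf, qPochInf, qPochInf,
    ← (multipliable_qPochInf hq0 hq1 _).tprod_mul (multipliable_qPochInf hq0 hq1 _)]
  congr 1; ext n; push_cast; ring

lemma qPochInf_mul_base {q : ℝ} (hq0 : 0 < q) (hq1 : q < 1) (a : ℂ) :
    qPochInf a (q ^ 2) * qPochInf (a * q) (q ^ 2) = qPochInf a q := by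
  have hp : (0 : ℝ) < q ^ 2 := by positivity
  have hp1 : q ^ 2 < 1 := by nlinarith
  have e0 : (fun n : ℕ => 1 - a * ((q ^ 2 : ℝ) : ℂ) ^ n) =
      fun n : ℕ => 1 - a * (q : ℂ) ^ (2 * n) := by
    ext n; push_cast; rw [pow_mul]
  have e1 : (fun n : ℕ => 1 - a * q * ((q ^ 2 : ℝ) : ℂ) ^ n) =
      fun n : ℕ => 1 - a * (q : ℂ) ^ (2 * n + 1) := by
    ext n; push_cast; rw [pow_succ _ (2 * n), pow_mul]; ring
  have h0 := multipliable_qPochInf hp hp1 a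
  have h1 := multipliable_qPochInf hp hp1 (a * q)
  rw [e0] at h0
  rw [e1] at h1
  have h := tprod_even_mul_odd (f := fun n : ℕ => 1 - a * (q : ℂ) ^ n) h0 h1
  rw [← e0, ← e1] at h
  exact h

/-- The exponents of `1 - q ^ 2` add up to `-1`, so only a theta product survives. With `κ = α - β`
it is the one in Jacobi's identity at `a = q ^ (α - β + 2 * x)`. -/
lemma inv_qGamma_sq_mul_inv_qGamma_sq {q : ℝ} (hq0 : 0 < q) (hq1 : q < 1) (κ x : ℂ) :
    (qGamma (q ^ 2) ((κ + 1) / 2 + x))⁻¹ * (qGamma (q ^ 2) ((-κ + 1) / 2 - x))⁻¹ =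
      qPochInf ((q : ℂ) ^ (κ + 2 * x) * q) (q ^ 2) * qPochInf (q / (q : ℂ) ^ (κ + 2 * x)) (q ^ 2) /
        (qPochInf ((q ^ 2 : ℝ) : ℂ) (q ^ 2) ^ 2 * ((1 - q ^ 2 : ℝ) : ℂ)) := by
  have hq : (q : ℂ) ≠ 0 := by exact_mod_cast hq0.ne'
  have hp1 : q ^ 2 < 1 := by nlinarith
  have h1 : ((1 - q ^ 2 : ℝ) : ℂ) ≠ 0 := by exact_mod_cast (sub_pos.mpr hp1).ne'
  rw [inv_qGamma, inv_qGamma, ofReal_sq_cpow hq0, ofReal_sq_cpow hq0,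
    show 2 * ((κ + 1) / 2 + x) = κ + 2 * x + 1 by ring,
    show 2 * ((-κ + 1) / 2 - x) = 1 - (κ + 2 * x) by ring, Complex.cpow_add _ _ hq,
    Complex.cpow_sub _ _ hq, Complex.cpow_one]
  have h2 : ((1 - q ^ 2 : ℝ) : ℂ) ^ ((κ + 1) / 2 + x - 1) *
      ((1 - q ^ 2 : ℝ) : ℂ) ^ ((-κ + 1) / 2 - x - 1) = (((1 - q ^ 2 : ℝ) : ℂ))⁻¹ := by
    rw [← Complex.cpow_add _ _ h1, ← Complex.cpow_neg_one]; congr 1; ring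
  rw [mul_mul_mul_comm, h2]
  ring

/-! ### Unfolding the integral and evaluating the constant -/

lemma antiperiodic_add_intCast {ω : ℝ → ℂ} (h : Function.Antiperiodic ω 1) (x : ℝ) (n : ℤ) :
    ω (x + n) = (-1) ^ n * ω x := by
  have h1 : ∀ y : ℝ, ω (y + 1) = -ω y := h
  induction n with
  | zero => simp
  | succ k ih =>
    have := h1 (x + (k : ℤ))
    rw [ih] at this
    rw [zpow_add_one₀ (by norm_num)]
    push_cast at this ⊢
    rw [← add_assoc, this]; ring
  | pred k ih =>
    have := h1 (x + ((-k - 1 : ℤ) : ℝ))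
    rw [show x + ((-k - 1 : ℤ) : ℝ) + 1 = x + ((-k : ℤ) : ℝ) by push_cast; ring, ih] at this
    rw [zpow_sub_one₀ (by norm_num)]
    linear_combination this

section Kernel

variable (q : ℝ) (α β γ δ : ℂ) (ω : ℝ → ℂ)

/-- The integrand on the real line. -/
noncomputable def gammaKernel (x : ℝ) : ℂ :=
  (q : ℂ) ^ ((α - β) * (x : ℂ) + (x : ℂ) ^ 2) * ω x /
    (qGamma q (α + x) * qGamma q (β - x) * qGamma q (γ + x) * qGamma q (δ - x))

/-- The factor of `gammaKernel` that does not take part in the summation over translates. -/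
noncomputable def gammaKernelFactor (x : ℝ) : ℂ :=
  (q : ℂ) ^ ((α - β) * (x : ℂ) + (x : ℂ) ^ 2) * ω x *
    (((1 - q : ℝ) : ℂ) ^ (α + β + γ + δ - 4) / qPochInf q q ^ 4)

variable {q α β γ δ ω}

lemma continuous_gammaKernel (hq0 : 0 < q) (hq1 : q < 1) (hcont : Continuous ω) :
    Continuous (gammaKernel q α β γ δ ω) := by
  have h1 := continuous_inv_qGamma hq0 hq1
  have h2 := continuous_ofReal_cpow hq0
  have e : gammaKernel q α β γ δ ω = fun x : ℝ =>
      (q : ℂ) ^ ((α - β) * (x : ℂ) + (x : ℂ) ^ 2) * ω x * ((qGamma q (α + x))⁻¹ *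
        (qGamma q (β - x))⁻¹ * (qGamma q (γ + x))⁻¹ * (qGamma q (δ - x))⁻¹) := by
    ext x; rw [gammaKernel, div_eq_mul_inv]; simp only [mul_inv]
  rw [e]
  have c1 : Continuous fun x : ℝ => (q : ℂ) ^ ((α - β) * (x : ℂ) + (x : ℂ) ^ 2) :=
    h2.comp (by fun_prop)
  have c2 : ∀ z : ℂ, Continuous fun x : ℝ => (qGamma q (z + x))⁻¹ := fun z =>
    h1.comp (by fun_prop : Continuous fun x : ℝ => z + (x : ℂ))
  have c3 : ∀ z : ℂ, Continuous fun x : ℝ => (qGamma q (z - x))⁻¹ := fun z =>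
    h1.comp (by fun_prop : Continuous fun x : ℝ => z - (x : ℂ))
  exact (c1.mul hcont).mul ((((c2 α).mul (c3 β)).mul (c2 γ)).mul (c3 δ))

lemma gammaKernel_add_intCast (hq0 : 0 < q) (hq1 : q < 1) (hbal : α + δ = β + γ)
    (hanti : Function.Antiperiodic ω 1) (x : ℝ) (n : ℤ) :
    gammaKernel q α β γ δ ω (x + n) = gammaKernelFactor q α β γ δ ω x *
      bilateralTerm q ((q : ℂ) ^ (α - β + 2 * x)) ((q : ℂ) ^ (β - x)) ((q : ℂ) ^ (δ - x)) n := by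
  have hq : (q : ℂ) ≠ 0 := by exact_mod_cast hq0.ne'
  have h1q : ((1 - q : ℝ) : ℂ) ≠ 0 := by exact_mod_cast (sub_pos.mpr hq1).ne'
  have eE : (q : ℂ) ^ ((α - β) * ((x + n : ℝ) : ℂ) + ((x + n : ℝ) : ℂ) ^ 2) =
      (q : ℂ) ^ ((α - β) * (x : ℂ) + (x : ℂ) ^ 2) * ((q : ℂ) ^ (α - β + 2 * x)) ^ n *
        (q : ℂ) ^ (n ^ 2) := by
    rw [← Complex.cpow_mul_int, ← Complex.cpow_intCast, ← Complex.cpow_add _ _ hq,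
      ← Complex.cpow_add _ _ hq]
    congr 1; push_cast; ring
  have ep : ∀ z : ℂ, (q : ℂ) ^ (z + ((x + n : ℝ) : ℂ)) = (q : ℂ) ^ (z + x) * (q : ℂ) ^ n := by
    intro z
    rw [← Complex.cpow_intCast, ← Complex.cpow_add _ _ hq]; congr 1; push_cast; ring
  have em : ∀ z : ℂ, (q : ℂ) ^ (z - ((x + n : ℝ) : ℂ)) = (q : ℂ) ^ (z - x) * (q : ℂ) ^ (-n) := by
    intro z
    rw [← Complex.cpow_intCast, ← Complex.cpow_add _ _ hq]; congr 1; push_cast; ring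
  have eab : (q : ℂ) ^ (α - β + 2 * x) * (q : ℂ) ^ (β - x) = (q : ℂ) ^ (α + x) := by
    rw [← Complex.cpow_add _ _ hq]; congr 1; ring
  have ead : (q : ℂ) ^ (α - β + 2 * x) * (q : ℂ) ^ (δ - x) = (q : ℂ) ^ (γ + x) := by
    rw [← Complex.cpow_add _ _ hq]; congr 1; linear_combination hbal
  have ec : ((1 - q : ℝ) : ℂ) ^ (α + β + γ + δ - 4) =
      ((1 - q : ℝ) : ℂ) ^ (α + ((x + n : ℝ) : ℂ) - 1) *
      ((1 - q : ℝ) : ℂ) ^ (β - ((x + n : ℝ) : ℂ) - 1) *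
      ((1 - q : ℝ) : ℂ) ^ (γ + ((x + n : ℝ) : ℂ) - 1) *
      ((1 - q : ℝ) : ℂ) ^ (δ - ((x + n : ℝ) : ℂ) - 1) := by
    rw [← Complex.cpow_add _ _ h1q, ← Complex.cpow_add _ _ h1q, ← Complex.cpow_add _ _ h1q]
    congr 1; ring
  rw [gammaKernel, gammaKernelFactor, div_eq_mul_inv, mul_inv, mul_inv, mul_inv, inv_qGamma,
    inv_qGamma, inv_qGamma, inv_qGamma, bilateralTerm, eab, ead, ec, eE, ep, ep, em, em,
    antiperiodic_add_intCast hanti]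
  ring

/-- The decay ratio does not depend on `x`, and the prefactor is continuous in `x`, so compactness
of `[0, 1]` gives one constant. -/
lemma exists_norm_gammaKernel_le (hq0 : 0 < q) (hq1 : q < 1) (hbal : α + δ = β + γ)
    (hcont : Continuous ω) (hanti : Function.Antiperiodic ω 1) :
    ∃ M : ℝ, ∀ x ∈ Set.Icc (0 : ℝ) 1, ∀ n : ℤ,
      ‖gammaKernel q α β γ δ ω (x + n)‖ ≤ M * (q ^ ((α + δ).re - 1)) ^ n.natAbs := by
  let A : ℝ → ℝ := fun x => q ^ ((α - β).re + 2 * x)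
  let R : ℝ → ℝ := fun x => q ^ (β.re - x)
  let S : ℝ → ℝ := fun x => q ^ (δ.re - x)
  have hA : ∀ x, 0 < A x := fun x => Real.rpow_pos_of_pos hq0 _
  have hR : ∀ x, 0 < R x := fun x => Real.rpow_pos_of_pos hq0 _
  have hS : ∀ x, 0 < S x := fun x => Real.rpow_pos_of_pos hq0 _
  have cpow : ∀ f : ℝ → ℝ, Continuous f → Continuous fun x => q ^ f x := fun f hf =>
    continuous_const.rpow hf fun _ => Or.inl hq0.ne'
  have cA : Continuous A := cpow _ (by fun_prop)
  have cR : Continuous R := cpow _ (by fun_prop)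
  have cS : Continuous S := cpow _ (by fun_prop)
  have cB : Continuous fun x => bilateralBound q (A x) (R x) (S x) := by
    unfold bilateralBound
    have h1 := cR.inv₀ fun x => (hR x).ne'
    have h2 := cS.inv₀ fun x => (hS x).ne'
    have h3 := (cA.mul cR).inv₀ fun x => (mul_pos (hA x) (hR x)).ne'
    have h4 := (cA.mul cS).inv₀ fun x => (mul_pos (hA x) (hS x)).ne'
    exact Real.continuous_exp.comp ((((cR.add h1).add (cS.add h2)).add ((cA.mul cR).add h3)).add
      ((cA.mul cS).add h4) |>.div_const _)
  have cF : Continuous (gammaKernelFactor q α β γ δ ω) := by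
    have c1 : Continuous fun x : ℝ => (q : ℂ) ^ ((α - β) * (x : ℂ) + (x : ℂ) ^ 2) :=
      (continuous_ofReal_cpow hq0).comp (by fun_prop)
    exact (c1.mul hcont).mul continuous_const
  obtain ⟨M, hM⟩ := isCompact_Icc.exists_bound_of_continuousOn (s := Set.Icc (0 : ℝ) 1)
    (f := fun x => ‖gammaKernelFactor q α β γ δ ω x‖ * bilateralBound q (A x) (R x) (S x))
    (by fun_prop)
  refine ⟨M, fun x hx n => ?_⟩
  have hρ : A x * R x * S x / q = q ^ ((α + δ).re - 1) := by
    simp only [A, R, S]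
    rw [← Real.rpow_add hq0, ← Real.rpow_add hq0]
    nth_rewrite 2 [← Real.rpow_one q]
    rw [← Real.rpow_sub hq0]
    congr 1
    simp only [Complex.sub_re, Complex.add_re]; ring
  have hb := norm_bilateralTerm_le hq0 hq1 (a := (q : ℂ) ^ (α - β + 2 * x))
    (b := (q : ℂ) ^ (β - x)) (d := (q : ℂ) ^ (δ - x)) (hA x) (hR x) (hS x)
    (by rw [Complex.norm_cpow_eq_rpow_re_of_pos hq0]; simp [A])
    (by rw [Complex.norm_cpow_eq_rpow_re_of_pos hq0]; simp [R])
    (by rw [Complex.norm_cpow_eq_rpow_re_of_pos hq0]; simp [S]) n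
  rw [gammaKernel_add_intCast hq0 hq1 hbal hanti, norm_mul, ← hρ]
  have hAx := hA x
  have hRx := hR x
  have hSx := hS x
  calc _ ≤ ‖gammaKernelFactor q α β γ δ ω x‖ *
        (bilateralBound q (A x) (R x) (S x) * (A x * R x * S x / q) ^ n.natAbs) := by gcongr
    _ = ‖gammaKernelFactor q α β γ δ ω x‖ * bilateralBound q (A x) (R x) (S x) *
        (A x * R x * S x / q) ^ n.natAbs := by ring
    _ ≤ M * (A x * R x * S x / q) ^ n.natAbs := by
        gcongr
        exact (Real.le_norm_self _).trans (hM x hx)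

/-- Integrability over the line, and unfolding of the integral over the translates of `[0, 1]`. -/
lemma integral_gammaKernel (hq0 : 0 < q) (hq1 : q < 1) (hbal : α + δ = β + γ)
    (hre : 1 < (α + δ).re) (hcont : Continuous ω) (hanti : Function.Antiperiodic ω 1) :
    Integrable (gammaKernel q α β γ δ ω) ∧
      ∫ x, gammaKernel q α β γ δ ω x = ∫ x in (0 : ℝ)..1, gammaKernelFactor q α β γ δ ω x *
        ∑' n, bilateralTerm q ((q : ℂ) ^ (α - β + 2 * x)) ((q : ℂ) ^ (β - x))
          ((q : ℂ) ^ (δ - x)) n := by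
  obtain ⟨M, hM⟩ := exists_norm_gammaKernel_le hq0 hq1 hbal hcont hanti
  have hsum : Summable fun n : ℤ => M * (q ^ ((α + δ).re - 1)) ^ n.natAbs :=
    (summable_pow_natAbs (Real.rpow_nonneg hq0.le _)
      (Real.rpow_lt_one hq0.le hq1 (by linarith))).mul_left _
  have hc : Continuous (gammaKernel q α β γ δ ω) := continuous_gammaKernel hq0 hq1 hcont
  have hint : Integrable (gammaKernel q α β γ δ ω) := by
    refine Real.integrable_of_summable_norm_Icc (f := ⟨_, hc⟩)
      (hsum.of_nonneg_of_le (fun _ => norm_nonneg _) fun n => ?_)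
    have h0 := (norm_nonneg _).trans (hM 0 (by simp) n)
    exact (ContinuousMap.norm_le _ h0).mpr fun x => hM x x.2 n
  refine ⟨hint, hint.hasSum_intervalIntegral_comp_add_int.unique ?_⟩
  refine intervalIntegral.hasSum_integral_of_dominated_convergence
    (fun n _ => M * (q ^ ((α + δ).re - 1)) ^ n.natAbs)
    (fun n => (hc.comp (continuous_add_const (n : ℝ))).aestronglyMeasurable)
    (fun n => ae_of_all _ fun x hx => ?_) (ae_of_all _ fun x _ => hsum)
    intervalIntegrable_const (ae_of_all _ fun x hx => ?_)
  · rw [Set.uIoc_of_le zero_le_one] at hx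
    exact hM x ⟨hx.1.le, hx.2⟩ n
  · rw [Set.uIoc_of_le zero_le_one] at hx
    have hs : Summable fun n : ℤ => gammaKernel q α β γ δ ω (x + n) :=
      (hsum.of_nonneg_of_le (fun _ => norm_nonneg _) (hM x ⟨hx.1.le, hx.2⟩)).of_norm
    rw [← tsum_mul_left]
    simp_rw [gammaKernel_add_intCast hq0 hq1 hbal hanti] at hs ⊢
    exact hs.hasSum

/-- Here `a * b ^ 2 = q ^ (α + β)` and `a * d ^ 2 = q ^ (γ + δ)` are free of `x`; these give the two
constant `Γ_{q²}` factors. -/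
lemma gammaKernelFactor_mul_tsum (hq0 : 0 < q) (hq1 : q < 1) (hbal : α + δ = β + γ)
    (hre : 1 < (α + δ).re) (x : ℝ) :
    gammaKernelFactor q α β γ δ ω x * ∑' n, bilateralTerm q ((q : ℂ) ^ (α - β + 2 * x))
        ((q : ℂ) ^ (β - x)) ((q : ℂ) ^ (δ - x)) n =
      qPoch (-(q : ℂ)) q (α + δ - 2) / (1 + (q : ℂ)) ^ (α + δ - 2) *
        (qGamma (q ^ 2) (1 / 2) ^ 2 /
          (qGamma (q ^ 2) ((α + β) / 2) * qGamma (q ^ 2) ((γ + δ) / 2) *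
            qGamma q (α + δ - 1))) *
        ((q : ℂ) ^ ((α - β) * (x : ℂ) + (x : ℂ) ^ 2) * ω x /
          (qGamma (q ^ 2) ((α - β + 1) / 2 + x) * qGamma (q ^ 2) ((β - α + 1) / 2 - x))) := by
  have hq : (q : ℂ) ≠ 0 := by exact_mod_cast hq0.ne'
  have hp0 : (0 : ℝ) < q ^ 2 := by positivity
  have hp1 : q ^ 2 < 1 := by nlinarith
  have h1q : ((1 - q : ℝ) : ℂ) ≠ 0 := by exact_mod_cast (sub_pos.mpr hq1).ne'
  have h1p : ((1 - q ^ 2 : ℝ) : ℂ) ≠ 0 := by exact_mod_cast (sub_pos.mpr hp1).ne'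
  have hqn : ‖(q : ℂ)‖ < 1 := by rwa [Complex.norm_real, Real.norm_of_nonneg hq0.le]
  have hpn : ‖((q ^ 2 : ℝ) : ℂ)‖ < 1 := by rwa [Complex.norm_real, Real.norm_of_nonneg hp0.le]
  set a : ℂ := (q : ℂ) ^ (α - β + 2 * x) with ha
  have ha0 : a ≠ 0 := by rw [ha, Complex.cpow_def_of_ne_zero hq]; exact Complex.exp_ne_zero _
  have es : a * (q : ℂ) ^ (β - x) * (q : ℂ) ^ (δ - x) / q = (q : ℂ) ^ (α + δ - 1) := by
    rw [ha, ← Complex.cpow_add _ _ hq, ← Complex.cpow_add _ _ hq]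
    nth_rewrite 2 [← Complex.cpow_one (q : ℂ)]
    rw [← Complex.cpow_sub _ _ hq]; congr 1; ring
  have hsn : ‖(q : ℂ) ^ (α + δ - 1)‖ < 1 := by
    rw [Complex.norm_cpow_eq_rpow_re_of_pos hq0]
    exact Real.rpow_lt_one hq0.le hq1 (by rw [Complex.sub_re, Complex.one_re]; linarith)
  have hb := tsum_bilateralTerm hq0 hq1 (a := a) (b := (q : ℂ) ^ (β - x)) (d := (q : ℂ) ^ (δ - x))
    ha0 (by rwa [es])
  have eab : a * ((q : ℂ) ^ (β - x)) ^ 2 = ((q ^ 2 : ℝ) : ℂ) ^ ((α + β) / 2) := by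
    rw [ofReal_sq_cpow hq0, sq, ha, ← Complex.cpow_add _ _ hq, ← Complex.cpow_add _ _ hq]
    congr 1; ring
  have ead : a * ((q : ℂ) ^ (δ - x)) ^ 2 = ((q ^ 2 : ℝ) : ℂ) ^ ((γ + δ) / 2) := by
    rw [ofReal_sq_cpow hq0, sq, ha, ← Complex.cpow_add _ _ hq, ← Complex.cpow_add _ _ hq]
    congr 1; linear_combination hbal
  rw [es, eab, ead] at hb
  have hneg : -(q : ℂ) * (q : ℂ) ^ (α + δ - 2) = -(q : ℂ) ^ (α + δ - 1) := by
    rw [neg_mul]; congr 1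
    nth_rewrite 1 [← Complex.cpow_one (q : ℂ)]
    rw [← Complex.cpow_add _ _ hq]; congr 1; ring
  have hΘ := inv_qGamma_sq_mul_inv_qGamma_sq hq0 hq1 (α - β) x
  rw [neg_sub, ← ha] at hΘ
  have hhalf : qGamma (q ^ 2) (1 / 2) ^ 2 =
      (qPochInf ((q ^ 2 : ℝ) : ℂ) (q ^ 2) / qPochInf q (q ^ 2)) ^ 2 * ((1 - q ^ 2 : ℝ) : ℂ) := by
    rw [qGamma, ofReal_sq_cpow hq0, mul_one_div_cancel two_ne_zero, Complex.cpow_one, mul_pow]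
    congr 1
    rw [sq, ← Complex.cpow_add _ _ h1p]
    norm_num
  have hw1 : ((1 - q : ℝ) : ℂ) ^ (α + β + γ + δ - 4) =
      ((1 - q : ℝ) : ℂ) ^ (α + δ - 2) * ((1 - q : ℝ) : ℂ) ^ (α + δ - 2) := by
    rw [← Complex.cpow_add _ _ h1q]; congr 1; linear_combination -hbal
  -- Factoring `1 - q ^ 2 = (1 - q) * (1 + q)` is the source of the power of `1 + q`.
  have hw2 : ((1 - q ^ 2 : ℝ) : ℂ) ^ ((α + β) / 2 - 1) * ((1 - q ^ 2 : ℝ) : ℂ) ^ ((γ + δ) / 2 - 1) =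
      ((1 - q : ℝ) : ℂ) ^ (α + δ - 2) * (1 + (q : ℂ)) ^ (α + δ - 2) := by
    have h1 : (1 + (q : ℂ)) = ((1 + q : ℝ) : ℂ) := by push_cast; rfl
    rw [← Complex.cpow_add _ _ h1p, h1, ← Complex.mul_cpow_ofReal_nonneg (by linarith)
      (by linarith), ← Complex.ofReal_mul]
    congr 2
    · ring
    · linear_combination -hbal / 2
  have h1w : (1 + (q : ℂ)) ^ (α + δ - 2) ≠ 0 := by
    have h1 : (1 + (q : ℂ)) ≠ 0 := by
      have : ((1 + q : ℝ) : ℂ) ≠ 0 := by exact_mod_cast (by positivity : (0 : ℝ) < 1 + q).ne'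
      simpa using this
    rw [Complex.cpow_def_of_ne_zero h1]; exact Complex.exp_ne_zero _
  have hX := qPochInf_ne_zero hq0 hq1 hqn
  have hP := qPochInf_ne_zero hp0 hp1 hpn
  have hO := qPochInf_ne_zero hp0 hp1 hqn
  have hs := qPochInf_ne_zero hq0 hq1 (a := -(q : ℂ) ^ (α + δ - 1)) (by rwa [norm_neg])
  have hYX := qPochInf_neg_mul_self hq0 hq1 (q : ℂ)
  have hOP := qPochInf_mul_base hq0 hq1 (q : ℂ)
  rw [← sq, ← Complex.ofReal_pow] at hOP
  rw [← Complex.ofReal_pow] at hYX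
  -- Follows from $(-q;q)_\infty(q;q)_\infty=(q^2;q^2)_\infty$ and
  -- $(q;q)_\infty=(q;q^2)_\infty(q^2;q^2)_\infty$.
  have hconst : qPochInf (-(q : ℂ)) q * qPochInf q q ^ 3 =
      qPochInf q (q ^ 2) ^ 2 * qPochInf ((q ^ 2 : ℝ) : ℂ) (q ^ 2) ^ 3 := by
    linear_combination qPochInf q q ^ 2 * hYX - qPochInf ((q ^ 2 : ℝ) : ℂ) (q ^ 2) *
      (qPochInf q q + qPochInf q (q ^ 2) * qPochInf ((q ^ 2 : ℝ) : ℂ) (q ^ 2)) * hOP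
  simp only [div_eq_mul_inv _ (qGamma _ _ * _), div_eq_mul_inv _ (_ * qGamma _ _), mul_inv, hΘ,
    hhalf]
  rw [inv_qGamma, inv_qGamma, inv_qGamma, gammaKernelFactor, hw1, qPoch, hneg,
    show α + δ - 1 - 1 = α + δ - 2 by ring]
  have hT := eq_div_of_mul_eq hs ((mul_comm _ _).trans hb)
  rw [hT]
  generalize hX' : qPochInf (q : ℂ) q = X at *
  generalize qPochInf (-(q : ℂ)) q = Y at *
  generalize qPochInf ((q ^ 2 : ℝ) : ℂ) (q ^ 2) = P at *
  generalize qPochInf (q : ℂ) (q ^ 2) = O at *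
  generalize ((1 - q : ℝ) : ℂ) ^ (α + δ - 2) = w at *
  generalize (1 + (q : ℂ)) ^ (α + δ - 2) = v at *
  generalize ((1 - q ^ 2 : ℝ) : ℂ) ^ ((α + β) / 2 - 1) = u₁ at *
  generalize ((1 - q ^ 2 : ℝ) : ℂ) ^ ((γ + δ) / 2 - 1) = u₂ at *
  generalize ((1 - q ^ 2 : ℝ) : ℂ) = m at *
  generalize qPochInf (-(q : ℂ) ^ (α + δ - 1)) q = s₁ at *
  have hXY : Y / (X * O ^ 2 * P ^ 3) = 1 / X ^ 4 := by
    field_simp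
    linear_combination hconst
  generalize (q : ℂ) ^ ((α - β) * (x : ℂ) + (x : ℂ) ^ 2) * ω x = E
  generalize qPochInf ((q : ℂ) ^ (α + δ - 1)) q = Z at *
  generalize qPochInf (((q ^ 2 : ℝ) : ℂ) ^ ((α + β) / 2)) (q ^ 2) = U at *
  generalize qPochInf (((q ^ 2 : ℝ) : ℂ) ^ ((γ + δ) / 2)) (q ^ 2) = V at *
  generalize qPochInf (a * q) (q ^ 2) = T₁ at *
  generalize qPochInf (q / a) (q ^ 2) = T₂ at *
  calc _ = E * T₁ * T₂ * U * V * Z * P / s₁ * w * (1 / X ^ 4) * ((w * v) / v) := by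
        field_simp
    _ = _ := by
        rw [← hXY, ← hw2]
        field_simp

end Kernel

theorem mainTheorem7 (q : ℝ) (hq0 : 0 < q) (hq1 : q < 1) (α β γ δ : ℂ)
    (hbal : α + δ = β + γ) (hre : 2 < (α + β + γ + δ).re)
    (ω : ℝ → ℂ) (hcont : Continuous ω) (hbdd : ∃ C : ℝ, ∀ x : ℝ, ‖ω x‖ ≤ C)
    (hanti : Function.Antiperiodic ω 1) :
    Integrable (fun x : ℝ =>
        (q : ℂ) ^ ((α - β) * (x : ℂ) + (x : ℂ) ^ 2) * ω x /
          (qGamma q (α + x) * qGamma q (β - x) * qGamma q (γ + x) * qGamma q (δ - x))) ∧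
    IntervalIntegrable (fun x : ℝ =>
        (q : ℂ) ^ ((α - β) * (x : ℂ) + (x : ℂ) ^ 2) * ω x /
          (qGamma (q ^ 2) ((α - β + 1) / 2 + x) * qGamma (q ^ 2) ((β - α + 1) / 2 - x)))
      volume 0 1 ∧
    ∫ x : ℝ, (q : ℂ) ^ ((α - β) * (x : ℂ) + (x : ℂ) ^ 2) * ω x /
        (qGamma q (α + x) * qGamma q (β - x) * qGamma q (γ + x) * qGamma q (δ - x)) =
      qPoch (-(q : ℂ)) q (α + δ - 2) / (1 + (q : ℂ)) ^ (α + δ - 2) *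
        (qGamma (q ^ 2) (1 / 2) ^ 2 /
          (qGamma (q ^ 2) ((α + β) / 2) * qGamma (q ^ 2) ((γ + δ) / 2) *
            qGamma q (α + δ - 1))) *
        ∫ x in (0 : ℝ)..1, (q : ℂ) ^ ((α - β) * (x : ℂ) + (x : ℂ) ^ 2) * ω x /
          (qGamma (q ^ 2) ((α - β + 1) / 2 + x) *
            qGamma (q ^ 2) ((β - α + 1) / 2 - x)) := by
  have hre' : 1 < (α + δ).re := by
    have h := congrArg Complex.re hbal
    simp only [Complex.add_re] at h hre ⊢
    linarith
  obtain ⟨hint, hval⟩ := integral_gammaKernel hq0 hq1 hbal hre' hcont hanti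
  refine ⟨hint, ?_, ?_⟩
  · have hp0 : (0 : ℝ) < q ^ 2 := by positivity
    have h1 := continuous_inv_qGamma hp0 (by nlinarith : q ^ 2 < 1)
    have c1 : Continuous fun x : ℝ => (q : ℂ) ^ ((α - β) * (x : ℂ) + (x : ℂ) ^ 2) :=
      (continuous_ofReal_cpow hq0).comp (by fun_prop)
    have c2 : Continuous fun x : ℝ => (qGamma (q ^ 2) ((α - β + 1) / 2 + x))⁻¹ :=
      h1.comp (by fun_prop : Continuous fun x : ℝ => (α - β + 1) / 2 + (x : ℂ))
    have c3 : Continuous fun x : ℝ => (qGamma (q ^ 2) ((β - α + 1) / 2 - x))⁻¹ :=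
      h1.comp (by fun_prop : Continuous fun x : ℝ => (β - α + 1) / 2 - (x : ℂ))
    simp_rw [div_eq_mul_inv _ (qGamma _ _ * _), mul_inv]
    exact ((c1.mul hcont).mul (c2.mul c3)).intervalIntegrable 0 1
  · refine hval.trans ?_
    rw [← intervalIntegral.integral_const_mul]
    simp_rw [gammaKernelFactor_mul_tsum hq0 hq1 hbal hre']
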